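/- Let $k$ be a number field with ring of integers $R$, let $a,b\in R$ be nonzero, and let $A=\left(\frac{a,b}{k}\right)$ be the quaternion algebra over $k$ with standard basis $1,i,j,ij$, where $i^2=a$, $j^2=b$, $ij=-ji$. A finite place $v$ of $k$ is ramified in $A$ if $A\otimes_k k_v$ is a division algebra; let $\Delta(A)$ be the product of the prime ideals of $R$ at which $A$ is ramified, and assume that $abR=\Delta(A)$. An order of $A$ is a finitely generated $R$-submodule of $A$ that spans $A$ over $k$ and is a subring containing $1$; it is maximal if it is maximal under inclusion among the orders of $A$. Write $R[e_1,\dots,e_4]$ for the $R$-submodule $Re_1+\cdots+Re_4$ of $A$. Then $\mathcal{O}'=R[1,i,j,ij]$ is an order of $A$. Let $x_0,x_1,x_2\in R$ be such that $\beta=\frac12(x_0+x_1i+x_2j)$ is integral over $R$, and let $\mathcal{O}=R[1,i,\beta,i\beta]$. Then $\mathcal{O}$ is a subring of $A$ containing $1$, all of whose elements are integral over $R$. If, in addition, $x_2\in R^{*}$, then $\mathcal{O}$ properly contains $\mathcal{O}'$ and is a maximal order of $A$. -/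

import Mathlib

open scoped NumberField TensorProduct Quaternion

noncomputable section

/-- A ring is a division ring: it is nontrivial and every nonzero element is invertible. -/
def IsDivisionAlg (B : Type*) [Ring B] : Prop :=
  Nontrivial B ∧ ∀ x : B, x ≠ 0 → IsUnit x

/-- `Ram_f(A)`: the finite places `v` of `k` such that `A ⊗ k_v` is a division algebra, where
`k_v` is the completion of `k` at `v`. -/
def finiteRamification (k : Type*) [Field k] [NumberField k] (A : Type*) [Ring A] [Algebra k A] :
    Set (IsDedekindDomain.HeightOneSpectrum (𝓞 k)) :=
  {v | IsDivisionAlg (A ⊗[k] v.adicCompletion k)}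

/-- The discriminant `Δ(A)`: the product of the prime ideals of the ring of integers at which `A`
is ramified (a finite set for a quaternion algebra `A`). -/
def quatDiscriminant (k : Type*) [Field k] [NumberField k] (A : Type*) [Ring A] [Algebra k A] :
    Ideal (𝓞 k) :=
  ∏ᶠ v ∈ finiteRamification k A, v.asIdeal

section Orders

variable {k : Type*} [Field k] [NumberField k] {A : Type*} [Ring A] [Algebra k A]
  [Algebra (𝓞 k) A] [IsScalarTower (𝓞 k) k A]

/-- An order of `A`: a complete `𝓞 k`-lattice of `A` (finitely generated over `𝓞 k` and spanning
`A` over `k`) which is also a ring with 1. -/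
structure IsQuatOrder (M : Submodule (𝓞 k) A) : Prop where
  isLattice : Submodule.IsLattice k M
  one_mem : (1 : A) ∈ M
  mul_mem : ∀ x ∈ M, ∀ y ∈ M, x * y ∈ M

/-- A maximal order of `A`: an order maximal with respect to inclusion among the orders of `A`. -/
def IsMaximalQuatOrder (M : Submodule (𝓞 k) A) : Prop :=
  IsQuatOrder M ∧ ∀ N : Submodule (𝓞 k) A, IsQuatOrder N → M ≤ N → N = M

/-- A ring of integers in `A`: an `𝓞 k`-submodule which is a ring with 1 and all of whose elements
are integral over `𝓞 k`. -/
structure IsRingOfIntegers (M : Submodule (𝓞 k) A) : Prop where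
  one_mem : (1 : A) ∈ M
  mul_mem : ∀ x ∈ M, ∀ y ∈ M, x * y ∈ M
  isIntegral : ∀ x ∈ M, IsIntegral (𝓞 k) x

end Orders

/-- The standard generator `i` (with `i² = a`) of the quaternion algebra `(a, b / k)`. -/
def quatI {k : Type*} [Field k] (a b : k) : ℍ[k, a, b] := ⟨0, 1, 0, 0⟩

/-- The standard generator `j` (with `j² = b`, `i j = - j i`) of `(a, b / k)`. -/
def quatJ {k : Type*} [Field k] (a b : k) : ℍ[k, a, b] := ⟨0, 0, 1, 0⟩

theorem quatI_mul_self {k : Type*} [Field k] (a b : k) :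
    quatI a b * quatI a b = algebraMap k _ a := by
  ext <;> simp [quatI, QuaternionAlgebra.algebraMap_eq]

theorem quatJ_mul_self {k : Type*} [Field k] (a b : k) :
    quatJ a b * quatJ a b = algebraMap k _ b := by
  ext <;> simp [quatJ, QuaternionAlgebra.algebraMap_eq]

theorem quatI_mul_quatJ {k : Type*} [Field k] (a b : k) :
    quatI a b * quatJ a b = -(quatJ a b * quatI a b) := by
  ext <;> simp [quatI, quatJ]

end

/-! For `x₂` a unit, `O` has reduced discriminant `ab x₂² R = Δ(A)`, which forces maximality.
Concretely, let `x` lie in an order `N ⊇ O`. The traces of `xO` are integral, so `x` is in the trace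
dual of `O` and `abx ∈ O` (`mul_smul_mem_span_of_trace`). It remains to show that `x` lies in `O`
locally at each prime `v ∣ ab`. Such a `v` is ramified and divides `ab` exactly once
(`exists_eq_mul_of_span_eq_quatDiscriminant`). For `θ = β` or `θ = i`, the order `R[θ] ⊆ O` has
discriminant prime to `v` (`notMem_or_four_mul_notMem`), and `A = k[θ] ⊕ ij k[θ]` is orthogonal for
the norm. The norm form of `R[θ]` is anisotropic modulo `v`: a zero would lift by Newton iteration
to a root in `k_v` and produce zero divisors (`mem_of_quadratic_form_mem`). Integrality of the norm
of `x` then removes the denominator `ab` from its `ij`-component at `v`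
(`exists_smul_mem_of_mem_prime`). -/

/-! ### Roots of quadratics over `k_v` and splitting -/

open Filter Topology in
/-- Newton iteration for a monic quadratic polynomial with unit discriminant over a complete
valued field. -/
theorem Valued.exists_quadratic_root {L : Type*} [Field L] [Valued L (WithZero (Multiplicative ℤ))]
    [CompleteSpace L] [T2Space L] (T N r₀ : L) (hD : Valued.v (T ^ 2 - 4 * N) = 1)
    (h₀ : Valued.v (r₀ ^ 2 - T * r₀ + N) < 1) : ∃ r : L, r ^ 2 - T * r + N = 0 := by
  let P : L → L := fun r => r ^ 2 - T * r + N
  let step : L → L := fun r => r - P r / (2 * r - T)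
  let u : ℕ → L := fun n => step^[n] r₀
  have hu : ∀ n, u (n + 1) = step (u n) := fun n => Function.iterate_succ_apply' _ _ _
  have h2 : Valued.v (2 : L) ≤ 1 := by
    rw [← one_add_one_eq_two]
    exact (Valuation.map_add _ _ _).trans (by simp)
  have h4 : Valued.v (4 : L) ≤ 1 := by
    rw [show (4 : L) = 2 * 2 by norm_num, map_mul]
    exact mul_le_one' h2 h2
  -- The square of the derivative `2r - T` is the discriminant plus `4 P(r)`.
  have hder : ∀ r, Valued.v (P r) < 1 → Valued.v (2 * r - T) = 1 := by
    intro r hr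
    have h : Valued.v ((2 * r - T) ^ 2) = 1 := by
      rw [show (2 * r - T) ^ 2 = 4 * P r + (T ^ 2 - 4 * N) by simp only [P]; ring, ← hD]
      apply Valuation.map_add_eq_of_lt_right
      rw [hD, map_mul]
      exact (mul_le_of_le_one_left' h4).trans_lt hr
    rw [map_pow] at h
    exact (pow_eq_one_iff_of_nonneg zero_le two_ne_zero).mp h
  -- `P(r - q) = P(r) - q P'(r) + q²`, and `q = P(r)/P'(r)` leaves only `q²`.
  have hstep : ∀ r, Valued.v (P r) < 1 → Valued.v (P (step r)) = Valued.v (P r) ^ 2 := by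
    intro r hr
    have h1 := hder r hr
    have h0 : 2 * r - T ≠ 0 := by
      intro h
      simp [h] at h1
    have : P (step r) = (P r / (2 * r - T)) ^ 2 := by
      have : P r = P r / (2 * r - T) * (2 * r - T) := by field_simp
      generalize hq : P r / (2 * r - T) = q at this ⊢
      simp only [step, hq]
      simp only [P] at this ⊢
      linear_combination this
    rw [this, map_pow, map_div₀, h1, div_one]
  have hP : ∀ n, Valued.v (P (u n)) ≤ Valued.v (P r₀) ^ (n + 1) := by
    intro n
    induction n with
    | zero => simp [u]
    | succ n ih =>
      have hlt : Valued.v (P (u n)) < 1 := ih.trans_lt (pow_lt_one₀ zero_le h₀ n.succ_ne_zero)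
      rw [hu, hstep _ hlt, sq, pow_succ]
      exact mul_le_mul' ih (ih.trans (pow_le_of_le_one zero_le h₀.le n.succ_ne_zero))
  have hlt : ∀ n, Valued.v (P (u n)) < 1 := fun n =>
    (hP n).trans_lt (pow_lt_one₀ zero_le h₀ n.succ_ne_zero)
  have hpow : Tendsto (fun n : ℕ => P r₀ ^ (n + 1)) atTop (𝓝 0) :=
    (Valued.tendsto_zero_pow_of_v_lt_one h₀).comp (tendsto_add_atTop_nat 1)
  have tendsto_of_le : ∀ w : ℕ → L, (∀ n, Valued.v (w n) ≤ Valued.v (P (u n))) →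
      Tendsto w atTop (𝓝 0) := by
    intro w hw
    rw [(Valued.hasBasis_nhds_zero L _).tendsto_right_iff] at hpow ⊢
    intro γ hγ
    filter_upwards [hpow γ hγ] with n hn
    have hle := (hw n).trans ((hP n).trans_eq (map_pow _ _ _).symm)
    exact lt_of_le_of_lt ((Valuation.restrict_le_iff _).mpr hle) hn
  have hPu := tendsto_of_le (fun n => P (u n)) fun _ => le_rfl
  have hdiff : Tendsto (fun n => u (n + 1) - u n) atTop (𝓝 0) := by
    refine tendsto_of_le _ fun n => ?_
    rw [hu, show step (u n) - u n = -(P (u n) / (2 * u n - T)) by simp only [step]; ring,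
      Valuation.map_neg, map_div₀, hder _ (hlt n), div_one]
  have : NonarchimedeanRing L := by
    rw [Valued.toUniformSpace_eq L (WithZero (Multiplicative ℤ))]
    exact Valued.v.subgroups_basis.nonarchimedean
  obtain ⟨r, hr⟩ := cauchySeq_tendsto_of_complete
    (NonarchimedeanAddGroup.cauchySeq_of_tendsto_sub_nhds_zero hdiff)
  have hcont : Continuous P := by fun_prop
  exact ⟨r, tendsto_nhds_unique ((hcont.tendsto r).comp hr) hPu⟩

/-- A division algebra over an extension field contains no noncentral root of a split quadratic
polynomial. -/
theorem not_isDivisionAlg_of_quadratic_root {k A L : Type*} [Field k] [Ring A] [Algebra k A]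
    [Field L] [Algebra k L] (θ γ : A) (hγ : γ * θ ≠ θ * γ) (t n : k)
    (hθ : θ * θ - t • θ + n • 1 = 0) (r : L)
    (hr : r ^ 2 - algebraMap k L t * r + algebraMap k L n = 0) : ¬ IsDivisionAlg (A ⊗[k] L) := by
  rintro ⟨hnt, hdiv⟩
  have hinj : Function.Injective (fun x : A => x ⊗ₜ[k] (1 : L)) :=
    Algebra.TensorProduct.includeLeft_injective (S := k) (algebraMap k L).injective
  have hcentral : ∀ ζ : A, γ * ζ ≠ ζ * γ → ζ ⊗ₜ[k] (1 : L) - 1 ⊗ₜ[k] r ≠ 0 := by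
    intro ζ hζ h
    apply hζ
    apply hinj
    have h' := sub_eq_zero.mp h
    calc (γ * ζ) ⊗ₜ[k] (1 : L) = (γ ⊗ₜ[k] (1 : L)) * (ζ ⊗ₜ[k] (1 : L)) := by simp
      _ = (ζ ⊗ₜ[k] (1 : L)) * (γ ⊗ₜ[k] (1 : L)) := by rw [h']; simp
      _ = (ζ * γ) ⊗ₜ[k] (1 : L) := by simp
  -- `θ` and `t - θ` have sum `t` and product `n`, so the product is `r² - tr + n`.
  have hprod : (θ ⊗ₜ[k] (1 : L) - 1 ⊗ₜ[k] r) * ((t • 1 - θ) ⊗ₜ[k] (1 : L) - 1 ⊗ₜ[k] r) = 0 := by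
    have h1 : θ * (t • 1 - θ) = n • (1 : A) := by
      rw [mul_sub, mul_smul_comm, mul_one]
      rw [← sub_eq_zero, ← neg_eq_zero, ← hθ]
      abel
    have h2 : r * r = algebraMap k L t * r - algebraMap k L n := by linear_combination hr
    rw [mul_sub] at h1
    simp only [mul_sub, sub_mul, Algebra.TensorProduct.tmul_mul_tmul, one_mul, mul_one, h2,
      TensorProduct.sub_tmul, TensorProduct.tmul_sub]
    have e1 : (θ * t • 1) ⊗ₜ[k] (1 : L) - (θ * θ) ⊗ₜ[k] (1 : L) = n • ((1 : A) ⊗ₜ[k] (1 : L)) := by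
      rw [← TensorProduct.sub_tmul, h1, TensorProduct.smul_tmul']
    have e2 : (1 : A) ⊗ₜ[k] (algebraMap k L t * r) = (t • (1 : A)) ⊗ₜ[k] r := by
      rw [← Algebra.smul_def, TensorProduct.smul_tmul]
    have e3 : (1 : A) ⊗ₜ[k] (algebraMap k L n) = n • ((1 : A) ⊗ₜ[k] (1 : L)) := by
      rw [Algebra.algebraMap_eq_smul_one, TensorProduct.tmul_smul]
    rw [e2, e3, ← e1]
    abel
  have hu := hdiv _ (hcentral θ hγ)
  have hu' := hdiv _ (hcentral (t • 1 - θ) (by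
    intro h
    apply hγ
    rw [mul_sub, sub_mul, mul_smul_comm, smul_mul_assoc, mul_one, one_mul] at h
    exact sub_right_injective h))
  rw [hu.mul_right_eq_zero] at hprod
  exact hu'.ne_zero hprod

open IsDedekindDomain in
/-- If the norm form of a separable quadratic order modulo `v` represents zero nontrivially modulo
`v`, then a quaternion algebra containing this order splits at `v`. -/
theorem mem_of_quadratic_form_mem {k A : Type*} [Field k] [NumberField k] [Ring A] [Algebra k A]
    (v : HeightOneSpectrum (𝓞 k)) (hv : v ∈ finiteRamification k A) (θ γ : A)
    (hγ : γ * θ ≠ θ * γ) (t n : 𝓞 k) (hθ : θ * θ - (t : k) • θ + (n : k) • 1 = 0)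
    (hD : t ^ 2 - 4 * n ∉ v.asIdeal) (e f : 𝓞 k)
    (hef : e ^ 2 + t * e * f + n * f ^ 2 ∈ v.asIdeal) : e ∈ v.asIdeal ∧ f ∈ v.asIdeal := by
  by_cases hf : f ∈ v.asIdeal
  · refine ⟨v.isPrime.mem_of_pow_mem 2 ?_, hf⟩
    have h := v.asIdeal.sub_mem hef (v.asIdeal.mul_mem_left (t * e + n * f) hf)
    convert h using 1
    ring
  · exfalso
    have hf0 : (f : k) ≠ 0 := by
      rintro h
      apply hf
      rw [NumberField.RingOfIntegers.coe_eq_zero_iff.mp h]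
      exact v.asIdeal.zero_mem
    have hval : ∀ x : k, Valued.v (algebraMap k (v.adicCompletion k) x) = v.valuation k x :=
      fun x => v.valuedAdicCompletion_eq_valuation' x
    have hvf : v.valuation k (f : k) = 1 := v.valuation_eq_one_iff_notMem.mpr hf
    -- The approximate root is `-e/f`, where the polynomial equals the norm form divided by the
    -- `v`-unit `f²`.
    obtain ⟨r, hr⟩ := Valued.exists_quadratic_root
      (algebraMap k (v.adicCompletion k) t) (algebraMap k (v.adicCompletion k) n)
      (algebraMap k (v.adicCompletion k) (-(e : k) / f)) (by
        have : v.valuation k ((t ^ 2 - 4 * n : 𝓞 k) : k) = 1 :=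
          v.valuation_eq_one_iff_notMem.mpr hD
        rw [← this, ← hval]
        simp only [map_sub, map_mul, map_pow, map_ofNat]) (by
        have h1 : v.valuation k ((e ^ 2 + t * e * f + n * f ^ 2 : 𝓞 k) : k) < 1 :=
          (v.valuation_lt_one_iff_mem _).mpr hef
        have h2 : (-(e : k) / f) ^ 2 - t * (-(e : k) / f) + n
            = ((e ^ 2 + t * e * f + n * f ^ 2 : 𝓞 k) : k) / f ^ 2 := by
          simp only [map_add, map_mul, map_pow]
          field_simp
          ring
        rw [← map_mul, ← map_pow, ← map_sub, ← map_add, hval, h2, map_div₀, map_pow, hvf]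
        simpa using h1)
    exact not_isDivisionAlg_of_quadratic_root θ γ hγ (t : k) (n : k) hθ r hr hv

/-! ### Primes of the discriminant; integrality of trace and norm -/

open IsDedekindDomain in
/-- A prime containing a generator of the discriminant is ramified and divides it exactly once. -/
theorem exists_eq_mul_of_span_eq_quatDiscriminant {k A : Type*} [Field k] [NumberField k]
    [Ring A] [Algebra k A] (d : 𝓞 k) (hd : Ideal.span {d} = quatDiscriminant k A)
    (v : HeightOneSpectrum (𝓞 k)) (hv : d ∈ v.asIdeal) :
    v ∈ finiteRamification k A ∧
      ∃ Q : Ideal (𝓞 k), Ideal.span {d} = v.asIdeal * Q ∧ ¬ Q ≤ v.asIdeal := by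
  classical
  have hle : Ideal.span {d} ≤ v.asIdeal := (Ideal.span_singleton_le_iff_mem _).mpr hv
  have hfin : (finiteRamification k A).Finite := by
    -- Over an infinite set `finprod` defaults to `1`, the unit ideal, which no prime contains.
    by_contra hinf
    have hsupp : (finiteRamification k A ∩
        Function.mulSupport fun v : HeightOneSpectrum (𝓞 k) => v.asIdeal) =
        finiteRamification k A := by
      apply Set.inter_eq_left.mpr
      intro w _
      simpa using w.isPrime.ne_top
    rw [hd, quatDiscriminant, finprod_mem_eq_one_of_infinite (by rwa [hsupp]), Ideal.one_eq_top]
      at hle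
    exact v.isPrime.ne_top (top_le_iff.mp hle)
  have hprod : Ideal.span {d} = ∏ w ∈ hfin.toFinset, w.asIdeal := by
    rw [hd, quatDiscriminant, finprod_mem_eq_finite_toFinset_prod _ hfin]
  have heq : ∀ w : HeightOneSpectrum (𝓞 k), w.asIdeal ≤ v.asIdeal → w = v := fun w hw =>
    HeightOneSpectrum.ext (w.isMaximal.eq_of_le v.isPrime.ne_top hw)
  have hmem : v ∈ hfin.toFinset := by
    rw [hprod, v.isPrime.prod_le] at hle
    obtain ⟨w, hw, hwv⟩ := hle
    exact heq w hwv ▸ hw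
  refine ⟨by simpa using hmem, ∏ w ∈ hfin.toFinset.erase v, w.asIdeal, ?_, ?_⟩
  · rw [hprod, Finset.mul_prod_erase _ _ hmem]
  · rw [v.isPrime.prod_le]
    rintro ⟨w, hw, hwv⟩
    exact (Finset.mem_erase.mp hw).1 (heq w hwv)

/-- The reduced trace and norm of an integral quaternion are integral. -/
theorem QuaternionAlgebra.exists_trace_norm_of_isIntegral {k : Type*} [Field k] [NumberField k]
    (a b : k) (x : ℍ[k, a, b]) (hx : IsIntegral (𝓞 k) x) :
    ∃ T N : 𝓞 k, (T : k) = 2 * x.re ∧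
      (N : k) = x.re ^ 2 - a * x.imI ^ 2 - b * x.imJ ^ 2 + a * b * x.imK ^ 2 := by
  by_cases hc : x = algebraMap k _ x.re
  · have hre : IsIntegral (𝓞 k) x.re := by
      rw [hc] at hx
      exact (isIntegral_algebraMap_iff (algebraMap k ℍ[k, a, b]).injective).mp hx
    obtain ⟨y, hy⟩ := IsIntegrallyClosed.isIntegral_iff.mp hre
    have hI : x.imI = 0 := by rw [hc]; simp [QuaternionAlgebra.algebraMap_eq]
    have hJ : x.imJ = 0 := by rw [hc]; simp [QuaternionAlgebra.algebraMap_eq]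
    have hK : x.imK = 0 := by rw [hc]; simp [QuaternionAlgebra.algebraMap_eq]
    refine ⟨2 * y, y ^ 2, ?_, ?_⟩ <;> simp only [map_mul, map_pow, map_ofNat, hy, hI, hJ, hK]
    ring
  -- For noncentral `x` the quadratic `q` is the minimal polynomial, so it divides the monic
  -- integral `P`; Gauss's lemma makes its coefficients integral.
  · obtain ⟨P, hP, hPx⟩ := hx
    let T : k := 2 * x.re
    let N : k := x.re ^ 2 - a * x.imI ^ 2 - b * x.imJ ^ 2 + a * b * x.imK ^ 2
    let q : Polynomial k := Polynomial.X ^ 2 - Polynomial.C T * Polynomial.X + Polynomial.C N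
    have hqm : q.Monic := by simp only [q]; monicity!
    have hqd : q.natDegree = 2 := by simp only [q]; compute_degree!
    have hqx : Polynomial.aeval x q = 0 := by
      simp only [q, map_add, map_sub, map_mul, map_pow, Polynomial.aeval_X, Polynomial.aeval_C]
      ext <;> simp [QuaternionAlgebra.algebraMap_eq, sq, T, N] <;> ring
    set p : Polynomial k := P.map (algebraMap (𝓞 k) k) with hp
    have hpx : Polynomial.aeval x p = 0 := by
      rw [hp, Polynomial.aeval_map_algebraMap]
      exact hPx
    have hrem : Polynomial.aeval x (p %ₘ q) = 0 := by
      have := congrArg (Polynomial.aeval x) (Polynomial.modByMonic_add_div p q)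
      simpa [hqx, hpx] using this
    have hdeg : (p %ₘ q).natDegree ≤ 1 := by
      have := Polynomial.natDegree_modByMonic_lt p hqm (by
        intro h; rw [h] at hqd; simp at hqd)
      omega
    obtain ⟨c, d, hcd⟩ := Polynomial.exists_eq_X_add_C_of_natDegree_le_one hdeg
    have hlin : algebraMap k ℍ[k, a, b] c * x + algebraMap k ℍ[k, a, b] d = 0 := by
      rw [hcd] at hrem
      simpa using hrem
    have hc0 : c = 0 := by
      by_contra hne
      apply hc
      have h1 := congrArg QuaternionAlgebra.imI hlin
      have h2 := congrArg QuaternionAlgebra.imJ hlin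
      have h3 := congrArg QuaternionAlgebra.imK hlin
      simp [QuaternionAlgebra.algebraMap_eq, hne] at h1 h2 h3
      ext <;> simp [QuaternionAlgebra.algebraMap_eq, h1, h2, h3]
    have hd0 : d = 0 := by
      have h := congrArg QuaternionAlgebra.re hlin
      simpa [hc0, QuaternionAlgebra.algebraMap_eq] using h
    have hdvd : q ∣ p := by
      rw [← Polynomial.modByMonic_eq_zero_iff_dvd hqm, hcd, hc0, hd0]
      simp
    obtain ⟨g, hg⟩ := IsIntegrallyClosed.eq_map_mul_C_of_dvd k hP hdvd
    rw [hqm.leadingCoeff, Polynomial.C_1, mul_one] at hg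
    have h0 := congrArg (fun s => Polynomial.coeff s 0) hg
    have h1 := congrArg (fun s => Polynomial.coeff s 1) hg
    simp only [Polynomial.coeff_map, q] at h0 h1
    refine ⟨-g.coeff 1, g.coeff 0, ?_, ?_⟩
    · have : (algebraMap (𝓞 k) k) (g.coeff 1) = -T := by
        rw [h1]; simp [Polynomial.coeff_C]
      simp [this, T]
    · have : (algebraMap (𝓞 k) k) (g.coeff 0) = N := by
        rw [h0]; simp
      simp [this, N]

/-! ### Spans of four elements and closure under products -/

theorem Submodule.mem_span_quadruple {R M : Type*} [Semiring R] [AddCommMonoid M] [Module R M]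
    {x w₀ w₁ w₂ w₃ : M} : x ∈ Submodule.span R {w₀, w₁, w₂, w₃} ↔
      ∃ c₀ c₁ c₂ c₃ : R, x = c₀ • w₀ + c₁ • w₁ + c₂ • w₂ + c₃ • w₃ := by
  simp only [Submodule.mem_span_insert, Submodule.mem_span_singleton]
  constructor
  · rintro ⟨c₀, _, ⟨c₁, _, ⟨c₂, _, ⟨c₃, rfl⟩, rfl⟩, rfl⟩, rfl⟩
    exact ⟨c₀, c₁, c₂, c₃, by abel⟩
  · rintro ⟨c₀, c₁, c₂, c₃, rfl⟩
    exact ⟨c₀, _, ⟨c₁, _, ⟨c₂, _, ⟨c₃, rfl⟩, rfl⟩, rfl⟩, by abel⟩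

theorem Submodule.mul_mem_span_of_forall_mem {R A : Type*} [CommSemiring R] [Semiring A]
    [Algebra R A] {S : Set A} (hS : ∀ x ∈ S, ∀ y ∈ S, x * y ∈ Submodule.span R S) :
    ∀ x ∈ Submodule.span R S, ∀ y ∈ Submodule.span R S, x * y ∈ Submodule.span R S := by
  intro x hx y hy
  have h := Submodule.mul_mem_mul hx hy
  rw [Submodule.span_mul_span] at h
  refine Submodule.span_le.mpr ?_ h
  rintro _ ⟨x, hx, y, hy, rfl⟩
  exact hS x hx y hy

theorem Submodule.isIntegral_of_mem_of_mul_mem {R A : Type*} [CommRing R] [Ring A] [Algebra R A]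
    {M : Submodule R A} (hfg : M.FG) (h1 : (1 : A) ∈ M) (hmul : ∀ x ∈ M, ∀ y ∈ M, x * y ∈ M)
    {x : A} (hx : x ∈ M) : IsIntegral R x :=
  IsIntegral.of_mem_of_fg (M.toSubalgebra h1 fun x y hx hy => hmul x hx y hy) hfg x hx

theorem QuaternionAlgebra.integer_smul_def {k : Type*} [Field k] {a b : k} (c : 𝓞 k) (x : ℍ[k, a, b]) :
    c • x = ⟨c * x.re, c * x.imI, c * x.imJ, c * x.imK⟩ := by
  ext <;> simp [Algebra.smul_def]

/-! ### Trace duality and containment at a prime -/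

/-- If the reduced trace pairs `x` integrally with `𝓞 k[1, i, β, iβ]`, then `abx` lies in this
module. -/
theorem mul_smul_mem_span_of_trace {k : Type*} [Field k] [NumberField k]
    (a b x₀ x₁ x₂ n u : 𝓞 k) (hu : u * x₂ = 1)
    (hn : 4 * n = x₀ ^ 2 - a * x₁ ^ 2 - b * x₂ ^ 2) (x β : ℍ[k, (a : k), (b : k)])
    (hβ : β = ⟨x₀ / 2, x₁ / 2, x₂ / 2, 0⟩)
    (htr : ∀ y ∈ Submodule.span (𝓞 k) {1, quatI (a : k) b, β, quatI (a : k) b * β},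
      ∃ T : 𝓞 k, (T : k) = 2 * (x * y).re)
    (hj : quatJ (a : k) b ∈ Submodule.span (𝓞 k) {1, quatI (a : k) b, β, quatI (a : k) b * β})
    (hij : quatI (a : k) b * quatJ (a : k) b ∈
      Submodule.span (𝓞 k) {1, quatI (a : k) b, β, quatI (a : k) b * β}) :
    (a * b) • x ∈ Submodule.span (𝓞 k) {1, quatI (a : k) b, β, quatI (a : k) b * β} := by
  obtain ⟨T₀, hT₀⟩ := htr 1 (Submodule.subset_span (by simp))
  obtain ⟨T₁, hT₁⟩ := htr _ (Submodule.subset_span (Or.inr (Or.inl rfl)))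
  obtain ⟨B, hB⟩ := htr β (Submodule.subset_span (by simp))
  obtain ⟨E, hE⟩ := htr _ (Submodule.subset_span (Or.inr (Or.inr (Or.inr rfl))))
  obtain ⟨T₂, hT₂⟩ := htr _ hj
  obtain ⟨T₃, hT₃⟩ := htr _ hij
  rw [Submodule.mem_span_quadruple]
  -- The last two coefficients are read off from the `j` and `ij` coordinates. In the first two,
  -- halves cancel through `x₂T₂ = 2B - x₀T₀ - x₁T₁`, `x₂T₃ = 2E - x₀T₁ - ax₁T₀` and the formula for
  -- `4n`.
  refine ⟨u ^ 2 * (a * T₀ * (2 * n + b * x₂ ^ 2) - a * x₀ * B + a * x₁ * E),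
    u ^ 2 * (-2 * n * T₁ + x₀ * E - a * x₁ * B), a * T₂ * u, -T₃ * u, ?_⟩
  have hu' : (u : k) * x₂ = 1 := by rw [← map_mul, hu, map_one]
  have hx2 : (x₂ : k) ≠ 0 := right_ne_zero_of_mul_eq_one hu'
  have hn' : (n : k) = (x₀ ^ 2 - a * x₁ ^ 2 - b * x₂ ^ 2) / 4 := by
    rw [eq_div_iff (by norm_num), mul_comm]
    have := congrArg (algebraMap (𝓞 k) k) hn
    simpa only [map_mul, map_sub, map_pow, map_ofNat] using this
  have hu2 : (u : k) = 1 / x₂ := by rw [eq_div_iff hx2, hu']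
  simp only [QuaternionAlgebra.integer_smul_def, map_mul, map_add, map_sub, map_neg, map_pow,
    map_ofNat, hT₀, hT₁, hB, hE, hT₂, hT₃, hn', hu2, hβ]
  ext <;> simp [quatI, quatJ] <;> field_simp <;> ring

open IsDedekindDomain in
/-- Let `d = ab` generate the discriminant and let `θ` be an integral element spanning, with `1`,
a quadratic order of discriminant prime to `v`. An element with integral reduced norm, paired
integrally by the reduced trace with an order containing `θ` and `ij`, lies in this order
locally at `v`. -/
theorem exists_smul_mem_of_mem_prime {k : Type*} [Field k] [NumberField k]
    (a b : 𝓞 k) (hab0 : a * b ≠ 0)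
    (v : HeightOneSpectrum (𝓞 k)) (hv : v ∈ finiteRamification k ℍ[k, (a : k), (b : k)])
    (hab : a * b ∈ v.asIdeal)
    (Q : Ideal (𝓞 k)) (hQ : Ideal.span {a * b} = v.asIdeal * Q) (hQv : ¬ Q ≤ v.asIdeal)
    (t y₁ y₂ n : 𝓞 k) (hn : t ^ 2 - 4 * n = a * y₁ ^ 2 + b * y₂ ^ 2)
    (hD : a * y₁ ^ 2 + b * y₂ ^ 2 ∉ v.asIdeal)
    (O : Submodule (𝓞 k) ℍ[k, (a : k), (b : k)]) (h1 : 1 ∈ O)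
    (hmul : ∀ x ∈ O, ∀ y ∈ O, x * y ∈ O)
    (hθ : (⟨t / 2, y₁ / 2, y₂ / 2, 0⟩ : ℍ[k, (a : k), (b : k)]) ∈ O)
    (hγ : (⟨0, 0, 0, 1⟩ : ℍ[k, (a : k), (b : k)]) ∈ O)
    (x : ℍ[k, (a : k), (b : k)]) (htr : ∀ y ∈ O, ∃ T : 𝓞 k, (T : k) = 2 * (x * y).re)
    (hnr : ∃ N : 𝓞 k,
      (N : k) = x.re ^ 2 - a * x.imI ^ 2 - b * x.imJ ^ 2 + a * b * x.imK ^ 2) :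
    ∃ c ∉ v.asIdeal, c • x ∈ O := by
  obtain ⟨T₀, hT₀⟩ := htr _ h1
  obtain ⟨T₁, hT₁⟩ := htr _ hθ
  obtain ⟨S₀, hS₀⟩ := htr _ hγ
  obtain ⟨S₁, hS₁⟩ := htr _ (hmul _ hγ _ hθ)
  obtain ⟨N, hN⟩ := hnr
  have hn' : (n : k) = (t ^ 2 - (a * y₁ ^ 2 + b * y₂ ^ 2)) / 4 := by
    have := congrArg (algebraMap (𝓞 k) k) hn
    simp only [map_mul, map_sub, map_add, map_pow, map_ofNat] at this
    rw [← this]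
    ring
  have ha : (a : k) ≠ 0 := by simpa using left_ne_zero_of_mul hab0
  have hb : (b : k) ≠ 0 := by simpa using right_ne_zero_of_mul hab0
  simp only [QuaternionAlgebra.re_mul] at hT₀ hT₁ hS₀ hS₁
  simp at hT₀ hT₁ hS₀ hS₁
  let D : 𝓞 k := a * y₁ ^ 2 + b * y₂ ^ 2
  -- Cramer's rule on the four traces, with determinant `±D`, gives `Dx = (p₀ + p₁θ) + ij(e +
  -- fθ)/(ab)`.
  let p₀ : 𝓞 k := (t ^ 2 - 2 * n) * T₀ - t * T₁
  let p₁ : 𝓞 k := 2 * T₁ - t * T₀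
  let e : 𝓞 k := 2 * n * S₀ - t * S₁
  let f : 𝓞 k := 2 * S₁ - t * S₀
  -- Take norms of this decomposition: the summands are orthogonal and `ij` has norm `ab`.
  have hform : e ^ 2 + t * e * f + n * f ^ 2 =
      (D ^ 2 * N - (p₀ ^ 2 + t * p₀ * p₁ + n * p₁ ^ 2)) * (a * b) := by
    apply NumberField.RingOfIntegers.coe_injective
    simp only [map_mul, map_add, map_sub, map_pow, map_ofNat, D, p₀, p₁, e, f, hn', hN,
      hT₀, hT₁, hS₀, hS₁]
    field_simp
    ring
  have hefv := mem_of_quadratic_form_mem v hv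
    (⟨t / 2, y₁ / 2, y₂ / 2, 0⟩ : ℍ[k, (a : k), (b : k)]) ⟨0, 0, 0, 1⟩ (by
      intro h
      have hI := congrArg QuaternionAlgebra.imI h
      have hJ := congrArg QuaternionAlgebra.imJ h
      simp at hI hJ
      have h₂ : (y₂ : k) = 0 := by
        have : (b : k) * y₂ = 0 := by linear_combination hI
        simpa [hb] using this
      have h₁ : (y₁ : k) = 0 := by
        have : (a : k) * y₁ = 0 := by linear_combination -hJ
        simpa [ha] using this
      rw [NumberField.RingOfIntegers.coe_eq_zero_iff] at h₁ h₂
      simp [h₁, h₂] at hD) t n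
    (by ext <;> simp [hn'] <;> (try simp only [Algebra.smul_def]) <;> field_simp <;> ring)
    (by rwa [hn]) e f
    (by rw [hform]; exact v.asIdeal.mul_mem_left _ hab)
  -- Multiplication by `m ∈ Q` sends `v` into `vQ = (ab)`, while `m` stays a unit at `v`.
  obtain ⟨m, hmQ, hmv⟩ := Set.not_subset.mp hQv
  have hdiv : ∀ z ∈ v.asIdeal, ∃ z', z' * (a * b) = z * m := fun z hz => by
    rw [← Ideal.mem_span_singleton', hQ]
    exact Ideal.mul_mem_mul hz hmQ
  obtain ⟨e', he'⟩ := hdiv e hefv.1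
  obtain ⟨f', hf'⟩ := hdiv f hefv.2
  refine ⟨m * D, fun h => (v.isPrime.mem_or_mem h).elim hmv hD, ?_⟩
  have hab' : (a : k) * b ≠ 0 := mul_ne_zero ha hb
  have he2 : (e' : k) = e * m / (a * b) := by
    rw [eq_div_iff hab', ← map_mul, ← map_mul, ← map_mul, he']
  have hf2 : (f' : k) = f * m / (a * b) := by
    rw [eq_div_iff hab', ← map_mul, ← map_mul, ← map_mul, hf']
  have key : (m * D) • x = (m * p₀) • (1 : ℍ[k, (a : k), (b : k)]) +
      (m * p₁) • ⟨t / 2, y₁ / 2, y₂ / 2, 0⟩ + e' • ⟨0, 0, 0, 1⟩ +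
      f' • (⟨0, 0, 0, 1⟩ * ⟨t / 2, y₁ / 2, y₂ / 2, 0⟩) := by
    simp only [QuaternionAlgebra.integer_smul_def, map_mul, map_add, map_sub, map_pow,
      map_ofNat, D, p₀, p₁, e, f, hn', he2, hf2, hT₀, hT₁, hS₀, hS₁]
    ext <;> simp <;> field_simp <;> ring
  rw [key]
  exact O.add_mem (O.add_mem (O.add_mem (O.smul_mem _ h1) (O.smul_mem _ hθ)) (O.smul_mem _ hγ))
    (O.smul_mem _ (hmul _ hγ _ hθ))

/-! ### Multiplication tables of the two orders -/

section

variable {R A : Type*} [CommRing R] [Ring A] [Algebra R A]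

theorem Submodule.mul_mem_span_one_i_j_ij {a b : R} {i j : A} (hi : i * i = a • 1)
    (hj : j * j = b • 1) (hji : j * i = -(i * j)) :
    ∀ x ∈ Submodule.span R {1, i, j, i * j}, ∀ y ∈ Submodule.span R {1, i, j, i * j},
      x * y ∈ Submodule.span R {1, i, j, i * j} := by
  have hiij : i * (i * j) = a • j := by rw [← mul_assoc, hi, smul_mul_assoc, one_mul]
  have hjij : j * (i * j) = -(b • i) := by
    rw [← mul_assoc, hji, neg_mul, mul_assoc, hj, mul_smul_comm, mul_one]
  apply Submodule.mul_mem_span_of_forall_mem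
  rintro x (rfl | rfl | rfl | rfl) y (rfl | rfl | rfl | rfl) <;>
    rw [Submodule.mem_span_quadruple]
  · exact ⟨1, 0, 0, 0, by simp⟩
  · exact ⟨0, 1, 0, 0, by simp⟩
  · exact ⟨0, 0, 1, 0, by simp⟩
  · exact ⟨0, 0, 0, 1, by simp⟩
  · exact ⟨0, 1, 0, 0, by simp⟩
  · exact ⟨a, 0, 0, 0, by simp [hi]⟩
  · exact ⟨0, 0, 0, 1, by simp⟩
  · exact ⟨0, 0, a, 0, by simp [hiij]⟩
  · exact ⟨0, 0, 1, 0, by simp⟩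
  · exact ⟨0, 0, 0, -1, by simp [hji]⟩
  · exact ⟨b, 0, 0, 0, by simp [hj]⟩
  · exact ⟨0, -b, 0, 0, by simp [hjij]⟩
  · exact ⟨0, 0, 0, 1, by simp⟩
  · exact ⟨0, 0, -a, 0, by simp [mul_assoc, hji, hiij]⟩
  · exact ⟨0, b, 0, 0, by simp [mul_assoc, hj]⟩
  · exact ⟨-(b * a), 0, 0, 0, by simp [mul_assoc, hjij, hi, smul_smul]⟩

/-- In the application `t` and `n` are the reduced trace and norm of `β`, and `s` is the trace of
`iβ`. -/
theorem Submodule.mul_mem_span_one_i_beta {a n t s : R} {i β : A} (hi : i * i = a • 1)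
    (hβi : β * i = s • 1 + t • i + -(i * β)) (hββ : β * β = (-n) • 1 + t • β) :
    ∀ x ∈ Submodule.span R {1, i, β, i * β}, ∀ y ∈ Submodule.span R {1, i, β, i * β},
      x * y ∈ Submodule.span R {1, i, β, i * β} := by
  have hiiβ : i * (i * β) = a • β := by rw [← mul_assoc, hi, smul_mul_assoc, one_mul]
  have hβiβ : β * (i * β) = n • i + s • β := by
    rw [← mul_assoc, hβi, add_mul, add_mul, neg_mul, mul_assoc, hββ, mul_add, mul_smul_comm,
      mul_smul_comm, smul_mul_assoc, smul_mul_assoc, mul_one, one_mul, neg_smul]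
    abel
  apply Submodule.mul_mem_span_of_forall_mem
  rintro x (rfl | rfl | rfl | rfl) y (rfl | rfl | rfl | rfl) <;>
    rw [Submodule.mem_span_quadruple]
  · exact ⟨1, 0, 0, 0, by simp⟩
  · exact ⟨0, 1, 0, 0, by simp⟩
  · exact ⟨0, 0, 1, 0, by simp⟩
  · exact ⟨0, 0, 0, 1, by simp⟩
  · exact ⟨0, 1, 0, 0, by simp⟩
  · exact ⟨a, 0, 0, 0, by simp [hi]⟩
  · exact ⟨0, 0, 0, 1, by simp⟩
  · exact ⟨0, 0, a, 0, by simp [hiiβ]⟩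
  · exact ⟨0, 0, 1, 0, by simp⟩
  · exact ⟨s, t, 0, -1, by simp [hβi]⟩
  · exact ⟨-n, 0, t, 0, by simp [hββ]⟩
  · exact ⟨0, n, s, 0, by simp [hβiβ]⟩
  · exact ⟨0, 0, 0, 1, by simp⟩
  · exact ⟨t * a, s, -a, 0, by
      simp [mul_assoc, hβi, mul_add, hi, hiiβ, smul_smul, add_comm]⟩
  · exact ⟨0, -n, 0, t, by simp [mul_assoc, hββ, mul_add]⟩
  · exact ⟨n * a, 0, 0, s, by simp [mul_assoc, hβiβ, mul_add, hi, smul_smul]⟩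

end

/-- The norm to `ℤ` is a positive power of `2`. This is what makes `O' < O` strict. -/
theorem not_isUnit_two {k : Type*} [Field k] [NumberField k] : ¬ IsUnit (2 : 𝓞 k) := by
  intro h
  have h1 := h.map (Algebra.norm ℤ)
  have h2 : Algebra.norm ℤ (2 : 𝓞 k) = 2 ^ Module.finrank ℤ (𝓞 k) := by
    simpa using Algebra.norm_algebraMap (S := 𝓞 k) (2 : ℤ)
  have hpos : Module.finrank ℤ (𝓞 k) ≠ 0 := Module.finrank_pos.ne'
  rw [h2, isUnit_pow_iff hpos] at h1
  exact absurd h1 (by decide)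

theorem isQuatOrder_span_one_i_j_ij {k : Type*} [Field k] (a b : 𝓞 k) :
    IsQuatOrder (Submodule.span (𝓞 k)
      {1, quatI (a : k) b, quatJ (a : k) b, quatI (a : k) b * quatJ (a : k) b}) where
  isLattice :=
    { fg := Submodule.fg_span (Set.toFinite _)
      span_eq_top := by
        rw [Submodule.span_span_of_tower, eq_top_iff]
        intro x _
        rw [Submodule.mem_span_quadruple]
        exact ⟨x.re, x.imI, x.imJ, x.imK, by ext <;> simp [quatI, quatJ]⟩ }
  one_mem := Submodule.subset_span (by simp)
  mul_mem := by
    have hi : quatI (a : k) b * quatI (a : k) b = a • 1 := by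
      rw [QuaternionAlgebra.integer_smul_def]
      ext <;> simp [quatI]
    have hj : quatJ (a : k) b * quatJ (a : k) b = b • 1 := by
      rw [QuaternionAlgebra.integer_smul_def]
      ext <;> simp [quatJ]
    have hji : quatJ (a : k) b * quatI (a : k) b = -(quatI (a : k) b * quatJ (a : k) b) := by
      rw [quatI_mul_quatJ, neg_neg]
    exact Submodule.mul_mem_span_one_i_j_ij hi hj hji

/-- The module `𝓞 k[1, i, β, iβ]` is closed under multiplication when the reduced norm `n` of
`β = (x₀ + x₁i + x₂j)/2` is integral. -/
theorem mul_mem_span_one_i_beta {k : Type*} [Field k] [NumberField k]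
    (a b x₀ x₁ x₂ n : 𝓞 k)
    (hn : 4 * n = x₀ ^ 2 - a * x₁ ^ 2 - b * x₂ ^ 2) (β : ℍ[k, (a : k), (b : k)])
    (hβ : β = ⟨x₀ / 2, x₁ / 2, x₂ / 2, 0⟩) :
    ∀ x ∈ Submodule.span (𝓞 k) {1, quatI (a : k) b, β, quatI (a : k) b * β},
    ∀ y ∈ Submodule.span (𝓞 k) {1, quatI (a : k) b, β, quatI (a : k) b * β},
      x * y ∈ Submodule.span (𝓞 k) {1, quatI (a : k) b, β, quatI (a : k) b * β} := by
  have hn' : (n : k) = (x₀ ^ 2 - a * x₁ ^ 2 - b * x₂ ^ 2) / 4 := by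
    rw [eq_div_iff (by norm_num), mul_comm]
    have := congrArg (algebraMap (𝓞 k) k) hn
    simpa only [map_mul, map_sub, map_pow, map_ofNat] using this
  have hi : quatI (a : k) b * quatI (a : k) b = a • 1 := by
    rw [QuaternionAlgebra.integer_smul_def]
    ext <;> simp [quatI]
  have hβi : β * quatI (a : k) b =
      (a * x₁) • 1 + x₀ • quatI (a : k) b + -(quatI (a : k) b * β) := by
    simp only [QuaternionAlgebra.integer_smul_def]
    ext <;> simp [quatI, hβ] <;> ring
  have hββ : β * β = (-n) • 1 + x₀ • β := by
    simp only [QuaternionAlgebra.integer_smul_def, map_neg, hn']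
    ext <;> simp [hβ] <;> ring
  exact Submodule.mul_mem_span_one_i_beta hi hβi hββ

/-! ### Choosing the quadratic order at a prime -/

/-- At a prime dividing `ab` exactly once, either `β` or `i` generates a quadratic order of
discriminant prime to it. -/
theorem notMem_or_four_mul_notMem {k : Type*} [Field k] [NumberField k]
    (a b x₀ x₁ x₂ n : 𝓞 k) (hx₂ : IsUnit x₂)
    (hn : 4 * n = x₀ ^ 2 - a * x₁ ^ 2 - b * x₂ ^ 2) (p Q : Ideal (𝓞 k)) [p.IsPrime] (hp : p ≠ ⊥)
    (hQ : Ideal.span {a * b} = p * Q) (hQp : ¬ Q ≤ p) :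
    a * x₁ ^ 2 + b * x₂ ^ 2 ∉ p ∨ 4 * a ∉ p := by
  have hsq : a * b ∉ p * p := by
    intro h
    apply hQp
    rw [← Ideal.dvd_iff_le]
    apply (mul_dvd_mul_iff_left (a := p) (by simpa using hp)).mp
    rw [← hQ, Ideal.dvd_iff_le]
    exact (Ideal.span_singleton_le_iff_mem _).mpr h
  have hprime : p.IsPrime := inferInstance
  by_contra! h
  obtain ⟨hD, h4⟩ := h
  have hx₂p : x₂ ∉ p := fun h => hprime.ne_top (p.eq_top_of_isUnit_mem h hx₂)
  have hbp : b * x₂ ^ 2 ∈ p → b ∈ p := fun h =>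
    (hprime.mem_or_mem h).resolve_right fun h => hx₂p (hprime.mem_of_pow_mem 2 h)
  -- If `a ∈ p`, then `D ∈ p` gives `b ∈ p` because `x₂` is a unit, so `ab ∈ p²`.
  have hap : a ∉ p := fun ha => hsq (Ideal.mul_mem_mul ha (hbp (by
    convert p.sub_mem hD (p.mul_mem_right (x₁ ^ 2) ha) using 1
    ring)))
  have h2 : (2 : 𝓞 k) ∈ p := hprime.mem_of_pow_mem 2 (by
    convert (hprime.mem_or_mem h4).resolve_right hap using 1
    norm_num)
  have hx₀ : x₀ ∈ p := hprime.mem_of_pow_mem 2 (by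
    convert p.add_mem hD (p.mul_mem_right (2 * n) h2) using 1
    linear_combination -hn)
  have h22 : (4 : 𝓞 k) ∈ p * p := by
    convert Ideal.mul_mem_mul h2 h2 using 1
    norm_num
  -- `D = x₀² - 4n`, with both `x₀` and `2` in `p`.
  have hDD : a * x₁ ^ 2 + b * x₂ ^ 2 ∈ p * p := by
    convert (p * p).sub_mem (Ideal.mul_mem_mul hx₀ hx₀) ((p * p).mul_mem_right n h22) using 1
    linear_combination hn
  by_cases hb : b ∈ p
  · have hx₁ : x₁ ∈ p := by
      refine hprime.mem_of_pow_mem 2 ((hprime.mem_or_mem ?_).resolve_left hap)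
      convert p.sub_mem hD (p.mul_mem_right (x₂ ^ 2) hb) using 1
      ring
    apply hsq
    obtain ⟨w, hw⟩ := hx₂.exists_left_inv
    convert (p * p).mul_mem_left (a * w ^ 2) ((p * p).sub_mem hDD
      ((p * p).mul_mem_left a (Ideal.mul_mem_mul hx₁ hx₁))) using 1
    linear_combination (-a * b * (w * x₂ + 1)) * hw
  · have hab : a * b ∈ p := by
      have : Ideal.span {a * b} ≤ p := hQ ▸ Ideal.mul_le_left
      exact (Ideal.span_singleton_le_iff_mem _).mp this
    exact (hprime.mem_or_mem hab).elim hap hb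

/-! ### The orders `O'` and `O` -/

theorem mainTheorem6 (k : Type*) [Field k] [NumberField k] (a b : 𝓞 k)
    (ha : a ≠ 0) (hb : b ≠ 0)
    (hab : Ideal.span {a * b} = quatDiscriminant k ℍ[k, (a : k), (b : k)])
    (i j : ℍ[k, (a : k), (b : k)]) (hi : i = quatI (a : k) (b : k))
    (hj : j = quatJ (a : k) (b : k))
    (O' : Submodule (𝓞 k) ℍ[k, (a : k), (b : k)])
    (hO' : O' = Submodule.span (𝓞 k) {1, i, j, i * j}) :
    IsQuatOrder O' ∧
    ∀ (x₀ x₁ x₂ : 𝓞 k) (β : ℍ[k, (a : k), (b : k)]),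
      β = (1 / 2 : k) • (x₀ • 1 + x₁ • i + x₂ • j) →
      IsIntegral (𝓞 k) β →
      ∀ O : Submodule (𝓞 k) ℍ[k, (a : k), (b : k)],
        O = Submodule.span (𝓞 k) {1, i, β, i * β} →
        IsRingOfIntegers O ∧
        (IsUnit x₂ → O' < O ∧ IsMaximalQuatOrder O) := by
  subst hi hj
  have hOrd' : IsQuatOrder O' := hO' ▸ isQuatOrder_span_one_i_j_ij a b
  refine ⟨hOrd', fun x₀ x₁ x₂ β hβ hβint O hO => ?_⟩
  replace hβ : β = ⟨x₀ / 2, x₁ / 2, x₂ / 2, 0⟩ := by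
    rw [hβ]
    simp only [QuaternionAlgebra.integer_smul_def]
    ext <;> simp [quatI, quatJ] <;> ring
  obtain ⟨n, hn⟩ : ∃ n : 𝓞 k, 4 * n = x₀ ^ 2 - a * x₁ ^ 2 - b * x₂ ^ 2 := by
    obtain ⟨_, n, -, hn⟩ := QuaternionAlgebra.exists_trace_norm_of_isIntegral _ _ β hβint
    refine ⟨n, NumberField.RingOfIntegers.coe_injective ?_⟩
    simp only [map_mul, map_sub, map_pow, map_ofNat, hn, hβ]
    ring
  have hmul := mul_mem_span_one_i_beta a b x₀ x₁ x₂ n hn β hβ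
  rw [← hO] at hmul
  have h1 : 1 ∈ O := hO ▸ Submodule.subset_span (by simp)
  have hiO : quatI (a : k) b ∈ O := hO ▸ Submodule.subset_span (by simp)
  have hβO : β ∈ O := hO ▸ Submodule.subset_span (by simp)
  have hfg : O.FG := hO ▸ Submodule.fg_span (Set.toFinite _)
  refine ⟨⟨h1, hmul, fun x hx => Submodule.isIntegral_of_mem_of_mul_mem hfg h1 hmul hx⟩,
    fun hx₂ => ?_⟩
  obtain ⟨u, hu⟩ := hx₂.exists_left_inv
  have hu' : (u : k) * x₂ = 1 := by rw [← map_mul, hu, map_one]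
  have hjO : quatJ (a : k) b ∈ O := by
    have h : quatJ (a : k) b =
        u • ((2 : 𝓞 k) • β - x₀ • 1 - x₁ • quatI (a : k) b) := by
      simp only [QuaternionAlgebra.integer_smul_def, map_ofNat]
      ext <;> simp [quatI, quatJ, hβ]
      · right
        ring
      · right
        ring
      · linear_combination -hu'
    rw [h]
    exact O.smul_mem _ (O.sub_mem (O.sub_mem (O.smul_mem _ hβO) (O.smul_mem _ h1))
      (O.smul_mem _ hiO))
  have hle : O' ≤ O := by
    rw [hO', Submodule.span_le]
    rintro x (rfl | rfl | rfl | rfl)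
    exacts [h1, hiO, hjO, hmul _ hiO _ hjO]
  have hlt : O' < O := by
    refine lt_of_le_of_ne hle fun heq => ?_
    rw [← heq, hO', Submodule.mem_span_quadruple] at hβO
    obtain ⟨c₀, c₁, c₂, c₃, hc⟩ := hβO
    -- The `j`-coordinate of `β` is `x₂/2`; its integrality would make `2` a unit.
    have h := congrArg QuaternionAlgebra.imJ hc
    simp only [QuaternionAlgebra.integer_smul_def] at h
    simp [quatI, quatJ, hβ] at h
    apply not_isUnit_two (k := k)
    refine IsUnit.of_mul_eq_one (c₂ * u) (NumberField.RingOfIntegers.coe_injective ?_)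
    simp only [map_mul, map_ofNat, map_one, ← h]
    linear_combination hu'
  have hOrd : IsQuatOrder O :=
    ⟨⟨hfg, top_le_iff.mp (hOrd'.isLattice.span_eq_top ▸ Submodule.span_mono hle)⟩, h1, hmul⟩
  refine ⟨hlt, hOrd, fun N hN hON => le_antisymm (fun x hx => ?_) hON⟩
  have htn : ∀ y ∈ N, ∃ T N : 𝓞 k, (T : k) = 2 * y.re ∧
      (N : k) = y.re ^ 2 - a * y.imI ^ 2 - b * y.imJ ^ 2 + a * b * y.imK ^ 2 := fun y hy =>
    QuaternionAlgebra.exists_trace_norm_of_isIntegral _ _ y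
      (Submodule.isIntegral_of_mem_of_mul_mem hN.isLattice.fg hN.one_mem hN.mul_mem hy)
  have htr : ∀ y ∈ O, ∃ T : 𝓞 k, (T : k) = 2 * (x * y).re := fun y hy =>
    let ⟨T, _, h, _⟩ := htn _ (hN.mul_mem x hx y (hON hy))
    ⟨T, h⟩
  obtain ⟨_, hnr⟩ := htn x hx
  replace hnr := hnr.imp fun _ h => h.2
  have habx : (a * b) • x ∈ O := by
    have := mul_smul_mem_span_of_trace a b x₀ x₁ x₂ n u hu hn x β hβ
    rw [← hO] at this
    exact this htr hjO (hmul _ hiO _ hjO)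
  -- The ideal of denominators of `x`. It contains `ab`, so only primes dividing `ab` can contain
  -- it.
  let I : Ideal (𝓞 k) := O.comap (LinearMap.toSpanSingleton (𝓞 k) _ x)
  have hI : ∀ c, c ∈ I ↔ c • x ∈ O := fun c => by simp [I]
  suffices hI1 : I = ⊤ by
    have h := (hI 1).mp (hI1 ▸ Submodule.mem_top)
    have h1x : (1 : 𝓞 k) • x = x := one_smul _ x
    rwa [h1x] at h
  by_contra hne
  obtain ⟨M, hM, hIM⟩ := Ideal.exists_le_maximal I hne
  have habM : a * b ∈ M := hIM ((hI _).mpr habx)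
  have hM0 : M ≠ ⊥ := by
    rintro rfl
    exact mul_ne_zero ha hb (Ideal.mem_bot.mp habM)
  let v : IsDedekindDomain.HeightOneSpectrum (𝓞 k) := ⟨M, hM.isPrime, hM0⟩
  obtain ⟨hv, Q, hQ, hQv⟩ := exists_eq_mul_of_span_eq_quatDiscriminant (a * b) hab v habM
  have hγO : (⟨0, 0, 0, 1⟩ : ℍ[k, (a : k), (b : k)]) ∈ O := by
    convert hmul _ hiO _ hjO using 1
    ext <;> simp [quatI, quatJ]
  have hlocal := exists_smul_mem_of_mem_prime a b (mul_ne_zero ha hb) v hv habM Q hQ hQv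
  obtain ⟨c, hc, hcx⟩ : ∃ c ∉ v.asIdeal, c • x ∈ O := by
    rcases notMem_or_four_mul_notMem a b x₀ x₁ x₂ n hx₂ hn v.asIdeal Q hM0 hQ hQv with h | h
    · exact hlocal x₀ x₁ x₂ n (by linear_combination -hn) h O h1 hmul (hβ ▸ hβO) hγO x htr hnr
    -- Here `θ = i`, of trace `0`, norm `-a` and discriminant `4a`.
    · refine hlocal 0 2 0 (-a) (by ring) (by convert h using 2; ring) O h1 hmul ?_ hγO x htr hnr
      convert hiO using 1
      ext <;> simp [quatI]
      exact (congrArg (· / (2 : k)) (map_ofNat (algebraMap (𝓞 k) k) 2)).trans (div_self two_ne_zero)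
  exact hc (hIM ((hI c).mpr hcx))
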